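/- Conventions. An ideal on a countable set $E$ is a family of subsets of $E$ that is closed under subsets and finite unions and contains all singletons $\{x\}$, $x\in E$, and the empty set (the improper ideal $\mathcal P(E)$ is allowed). It is coanalytic if, under the identification of subsets of $E$ with their characteristic functions, it is a coanalytic subset of $2^E$. A set $b\subseteq E$ is $J$-positive if $b\notin J$. An ideal $J$ on $E$ is weakly selective if for every $J$-positive set $b\subseteq E$ and every function $f:b\to\omega$ there is a $J$-positive set $a\subseteq b$ such that $f\restriction a$ is one-to-one or constant. An ideal $J$ on $E$ has a topological representation if there are a separable metrizable space $X$, a $\sigma$-ideal $I$ of subsets of $X$ containing all singletons, a countable dense set $D\subseteq X$ and a bijection $\rho:E\to D$ such that $J=\{a\subseteq E:\overline{\rho(a)}\in I\}$, where the closure is taken in $X$. **Theorem.** Let $J$ be a coanalytic ideal on a countable set $E$. The following are equivalent: (i) $J$ is weakly selective; (ii) $J$ is the intersection of a family of ideals on $E$ each of which has a topological representation. (The intersection of the empty family is understood as $\mathcal P(E)$.) -/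

import Mathlib

/-- An ideal on the set `E`: a nonempty family of subsets of `E` closed under subsets and finite
unions (`Order.Ideal (Set E)`) that contains all singletons. The improper ideal of all subsets of
`E` is allowed. -/
def ContainsSingletons {E : Type*} (J : Order.Ideal (Set E)) : Prop :=
  ∀ x : E, ({x} : Set E) ∈ J

/-- `J`, viewed as a subset of the Cantor space `2^E` through characteristic functions, is
coanalytic: the set of characteristic functions of `J`-positive sets is analytic. -/
def IsCoanalytic {E : Type*} (J : Order.Ideal (Set E)) : Prop :=
  MeasureTheory.AnalyticSet ({x : E → Bool | {e : E | x e = true} ∈ J}ᶜ)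

/-- `J` is weakly selective: every function from a `J`-positive set `b` to `ω` is one-to-one or
constant on some `J`-positive subset of `b`. (Functions on `b` are given as restrictions of
functions on `E`; every function on `b` is such a restriction.) -/
def IsWeaklySelective {E : Type*} (J : Order.Ideal (Set E)) : Prop :=
  ∀ (b : Set E) (f : E → ℕ), b ∉ J →
    ∃ a : Set E, a ⊆ b ∧ a ∉ J ∧ (Set.InjOn f a ∨ ∃ n : ℕ, ∀ x ∈ a, f x = n)

/-- A σ-ideal of subsets of `X` that contains all singletons. -/
structure IsSigmaIdeal {X : Type*} (I : Set (Set X)) : Prop where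
  empty_mem : ∅ ∈ I
  mem_of_subset : ∀ s t : Set X, s ⊆ t → t ∈ I → s ∈ I
  iUnion_mem : ∀ s : ℕ → Set X, (∀ n, s n ∈ I) → (⋃ n, s n) ∈ I
  singleton_mem : ∀ x : X, {x} ∈ I

/-- The family `J_I` of those subsets of `D` whose closure in `X` belongs to `I`. -/
def closureFamily {X : Type*} [TopologicalSpace X] (I : Set (Set X)) (D : Set X) : Set (Set D) :=
  {a : Set D | closure ((fun d : D => (d : X)) '' a) ∈ I}

/-- `J` has a topological representation: there are a separable metrizable space `X`, a σ-ideal `I`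
on `X` containing all singletons, a countable dense set `D` in `X` and a bijection `ρ : E → D`
such that `a ∈ J` if and only if `ρ(a) ∈ J_I`. (A separable metrizable space has at most continuum
many points, so `X : Type` is no restriction.) -/
def HasTopologicalRepresentation {E : Type*} (J : Order.Ideal (Set E)) : Prop :=
  ∃ (X : Type) (_ : TopologicalSpace X),
    TopologicalSpace.SeparableSpace X ∧ TopologicalSpace.MetrizableSpace X ∧
    ∃ (I : Set (Set X)) (D : Set X) (ρ : E ≃ D),
      IsSigmaIdeal I ∧ D.Countable ∧ Dense D ∧
      ∀ a : Set E, a ∈ J ↔ ρ '' a ∈ closureFamily I D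

/-!
Call a set positive if it is not in the ideal under consideration.

**Represented ideals are weakly selective.** Suppose that `b` is positive and all fibres of `f` on
`b` are in the ideal. The points of the closure of `b` outside the closures of the fibres form a set
`C ∉ I`, and every neighbourhood of a point of `C` meets infinitely many fibres. So an injective
choice of values of `f`, one for each basic open set that meets `C`, yields a set whose closure
contains `C` and on which `f` is injective. Weak selectivity passes to intersections, because a set
positive for the intersection is positive for a member of the family.

**Weakly selective coanalytic ideals are intersections of represented ideals.** Given a positive
set `b`, it suffices to find an ideal with a topological representation that includes `J` and omits
`b` (`IsWeaklySelective.exists_representation`). The main step is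
`IsWeaklySelective.exists_escaping`: `b` has countably many positive subsets such that no `a ∈ J`
meets all of them. For the proof, write the family of positive sets as the continuous image under
`g` of the Baire space. A pair of a finite set `F` and a finite sequence `t` is admissible if, however
sets `h G ∈ J` are assigned to finite sets `G`, there is a `y` extending `t` such that `g y ⊆ b` has
`F` as an initial segment and beyond `F` avoids `h G` after each of its initial segments `G`. Weak
selectivity makes `(∅, [])` admissible (`IsWeaklySelective.exists_isSparse`). From an admissible
pair, one can add elements, each ranging over a positive set, until `t` can be lengthened
(`IsAdmissible.canExtend`). These positive sets, over all admissible pairs, form the desired family: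
if some `a ∈ J` met all of them, then admissible pairs would grow inside `a`, and by continuity of
`g` their limit would be a positive subset of `a`.

Iterating this step gives a countable family `X` of positive sets, starting with `b`, in which every
member has, for each `a ∈ J`, a subset in the family that is disjoint from `a`, and also has two
disjoint subsets in the family. The characteristic functions of the members of `X` (and of the
points of `E`) embed `E` into a Cantor space. By compactness, the closure of `b` there is not covered
by countably many points and closures of sets of `J`: some decreasing sequence in `X` avoids them
one after another. So the `σ`-ideal generated by these points and closures represents an ideal
that omits `b`.
-/

open Set Filter Topology

/-! ### Ideals and injective choices -/

namespace Order.Ideal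

variable {E : Type*} {J : Order.Ideal (Set E)}

theorem mem_of_subset {s t : Set E} (hst : s ⊆ t) (ht : t ∈ J) : s ∈ J :=
  J.lower hst ht

theorem union_mem {s t : Set E} (hs : s ∈ J) (ht : t ∈ J) : s ∪ t ∈ J :=
  Order.Ideal.sup_mem hs ht

theorem empty_mem_set : (∅ : Set E) ∈ J :=
  J.bot_mem

theorem biUnion_finset_mem {ι : Type*} (T : Finset ι) {s : ι → Set E}
    (hs : ∀ i ∈ T, s i ∈ J) : (⋃ i ∈ T, s i) ∈ J := by
  classical
  induction T using Finset.induction_on with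
  | empty => simpa using empty_mem_set
  | insert i T _ ih =>
    rw [Finset.set_biUnion_insert]
    exact union_mem (hs i (Finset.mem_insert_self i T))
      (ih fun j hj => hs j (Finset.mem_insert_of_mem hj))

theorem finite_mem (hJ : ContainsSingletons J) {s : Set E} (hs : s.Finite) : s ∈ J := by
  refine mem_of_subset (t := ⋃ x ∈ hs.toFinset, {x}) (fun x hx => ?_)
    (biUnion_finset_mem _ fun x _ => hJ x)
  simpa using hx

theorem infinite_of_notMem (hJ : ContainsSingletons J) {s : Set E} (hs : s ∉ J) : s.Infinite :=
  fun h => hs (finite_mem hJ h)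

end Order.Ideal

open Order.Ideal

/-- A countable family of infinite sets has an injective choice function. -/
theorem exists_injective_choice {ι α : Type*} [Countable ι] {S : ι → Set α}
    (hS : ∀ i, (S i).Infinite) : ∃ v : ι → α, Function.Injective v ∧ ∀ i, v i ∈ S i := by
  classical
  rcases isEmpty_or_nonempty ι with hι | ⟨⟨i₀⟩⟩
  · exact ⟨fun i => hι.elim i, fun i => hι.elim i, fun i => hι.elim i⟩
  obtain ⟨enc⟩ := nonempty_encodable ι
  have key : ∀ (i : ι) (T : Finset α), ∃ x ∈ S i, x ∉ T := fun i T => (hS i).exists_notMem_finset T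
  choose c hcS hcT using key
  let idx : ℕ → ι := fun n => (Encodable.decode n).getD i₀
  let T : ℕ → Finset α := fun n => Nat.rec ∅ (fun n T => insert (c (idx n) T) T) n
  have hTsucc : ∀ n, T (n + 1) = insert (c (idx n) (T n)) (T n) := fun n => rfl
  have hTmono : Monotone T := monotone_nat_of_le_succ fun n => by
    rw [hTsucc]; exact Finset.subset_insert _ _
  have hlt : ∀ m n, m < n → c (idx m) (T m) ≠ c (idx n) (T n) := by
    intro m n hmn heq
    apply hcT (idx n) (T n)
    rw [← heq]
    exact hTmono hmn (by rw [hTsucc]; exact Finset.mem_insert_self _ _)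
  refine ⟨fun i => c (idx (Encodable.encode i)) (T (Encodable.encode i)), fun i j hij => ?_,
    fun i => ?_⟩
  · by_contra hne
    rcases lt_or_gt_of_ne (fun h => hne (Encodable.encode_injective h)) with h | h
    · exact hlt _ _ h hij
    · exact hlt _ _ h hij.symm
  · have : idx (Encodable.encode i) = i := by simp [idx]
    simpa [this] using hcS i (T (Encodable.encode i))

/-! ### Represented ideals are weakly selective -/

theorem HasTopologicalRepresentation.isWeaklySelective {E : Type*} {K : Order.Ideal (Set E)}
    (hK : HasTopologicalRepresentation K) : IsWeaklySelective K := by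
  obtain ⟨X, _, _, _, I, D, ρ, hI, -, -, hmem⟩ := hK
  have : SecondCountableTopology X := by
    let _ := TopologicalSpace.metrizableSpaceMetric X
    exact UniformSpace.secondCountable_of_separable X
  let e : E → X := fun x => (ρ x : X)
  have hmem' : ∀ a, a ∈ K ↔ closure (e '' a) ∈ I := by
    intro a
    rw [hmem a, closureFamily, mem_ofPred_eq, image_image]
  intro b f hb
  by_cases hfib : ∃ n, b ∩ f ⁻¹' {n} ∉ K
  · obtain ⟨n, hn⟩ := hfib
    exact ⟨_, inter_subset_left, hn, Or.inr ⟨n, fun x hx => hx.2⟩⟩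
  push Not at hfib
  let C : Set X := closure (e '' b) \ ⋃ n, closure (e '' (b ∩ f ⁻¹' {n}))
  have hC : C ∉ I := by
    intro hC
    refine hb ((hmem' b).2 ?_)
    refine hI.mem_of_subset _
      (⋃ n : ℕ, Nat.casesOn n C fun n => closure (e '' (b ∩ f ⁻¹' {n}))) (fun x hx => ?_)
      (hI.iUnion_mem _ fun n => ?_)
    · by_cases hx' : x ∈ ⋃ n, closure (e '' (b ∩ f ⁻¹' {n}))
      · obtain ⟨n, hn⟩ := mem_iUnion.1 hx'
        exact mem_iUnion.2 ⟨n + 1, hn⟩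
      · exact mem_iUnion.2 ⟨0, hx, hx'⟩
    · cases n with
      | zero => exact hC
      | succ n => exact (hmem' _).1 (hfib n)
  let B : Set (Set X) := {U ∈ TopologicalSpace.countableBasis X | (U ∩ C).Nonempty}
  have hBc : B.Countable := (TopologicalSpace.countable_countableBasis X).mono fun U hU => hU.1
  have : Countable B := hBc.to_subtype
  -- A neighbourhood of a point of `C` meets infinitely many fibres of `f`, because the point lies
  -- outside the closed union of any finitely many of them.
  have hinf : ∀ U : B, (f '' (b ∩ e ⁻¹' (U : Set X))).Infinite := by
    rintro ⟨U, hU, x, hxU, hxb, hx⟩ hfin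
    have hUo : IsOpen U := TopologicalSpace.isOpen_of_mem_countableBasis hU
    apply hx
    have hcl : IsClosed (⋃ n ∈ f '' (b ∩ e ⁻¹' U), closure (e '' (b ∩ f ⁻¹' {n}))) :=
      hfin.isClosed_biUnion fun _ _ => isClosed_closure
    have hsub : U ∩ e '' b ⊆ ⋃ n ∈ f '' (b ∩ e ⁻¹' U), closure (e '' (b ∩ f ⁻¹' {n})) := by
      rintro _ ⟨hyU, k, hk, rfl⟩
      exact mem_biUnion (mem_image_of_mem f ⟨hk, hyU⟩)
        (subset_closure (mem_image_of_mem e ⟨hk, rfl⟩))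
    have := closure_minimal hsub hcl (hUo.inter_closure ⟨hxU, hxb⟩)
    obtain ⟨n, -, hn⟩ := mem_iUnion₂.1 this
    exact mem_iUnion.2 ⟨n, hn⟩
  obtain ⟨v, hv, hvmem⟩ := exists_injective_choice hinf
  choose w hw hwv using hvmem
  refine ⟨range w, ?_, fun ha => hC ?_, Or.inl ?_⟩
  · rintro _ ⟨U, rfl⟩
    exact (hw U).1
  · refine hI.mem_of_subset _ _ (fun x hx => ?_) ((hmem' _).1 ha)
    rw [(TopologicalSpace.isBasis_countableBasis X).mem_closure_iff]
    intro U hU hxU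
    exact ⟨e (w ⟨U, hU, x, hxU, hx⟩), (hw ⟨U, hU, x, hxU, hx⟩).2, mem_image_of_mem e ⟨_, rfl⟩⟩
  · rintro _ ⟨U, rfl⟩ _ ⟨V, rfl⟩ h
    rw [hwv, hwv] at h
    rw [hv h]

/-! ### Sparse positive sets -/

section Sparse

variable {E : Type*} {J : Order.Ideal (Set E)}

/-- A positive set contains a positive set that meets each of countably many given sets of the
ideal in a finite set. -/
theorem IsWeaklySelective.exists_finite_inter (hw : IsWeaklySelective J) {ι : Type*} [Countable ι]
    {H : ι → Set E} (hH : ∀ i, H i ∈ J) {b : Set E} (hb : b ∉ J) :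
    ∃ a ⊆ b, a ∉ J ∧ ∀ i, (a ∩ H i).Finite := by
  classical
  obtain ⟨enc⟩ := nonempty_encodable ι
  -- `f x` is the successor of the least code of an index `i` with `x ∈ H i`, or `0`.
  let f : E → ℕ := fun x =>
    if h : ∃ n, ∃ i, Encodable.encode i = n ∧ x ∈ H i then Nat.find h + 1 else 0
  have hf : ∀ i, ∀ x ∈ H i, f x ∈ Finset.Icc 1 (Encodable.encode i + 1) := by
    intro i x hx
    have h : ∃ n, ∃ i, Encodable.encode i = n ∧ x ∈ H i := ⟨_, i, rfl, hx⟩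
    have : Nat.find h ≤ Encodable.encode i := Nat.find_min' h ⟨i, rfl, hx⟩
    simp only [f, dif_pos h, Finset.mem_Icc]
    omega
  obtain ⟨a, hab, ha, hinj | ⟨n, hn⟩⟩ := hw b f hb
  · refine ⟨a, hab, ha, fun i => ?_⟩
    refine Finite.of_finite_image (f := f)
      ((Finset.finite_toSet (Finset.Icc 1 (Encodable.encode i + 1))).subset ?_)
      (hinj.mono inter_subset_left)
    rintro _ ⟨x, hx, rfl⟩
    exact hf i x hx.2
  · refine ⟨a, hab, ha, fun i => ?_⟩
    suffices a ∩ H i = ∅ by rw [this]; exact finite_empty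
    by_contra hne
    obtain ⟨x, hxa, hxi⟩ := nonempty_iff_ne_empty.2 hne
    have h : ∃ n, ∃ i, Encodable.encode i = n ∧ x ∈ H i := ⟨_, i, rfl, hxi⟩
    have hj : ∀ z ∈ a, f z = f x := fun z hz => (hn z hz).trans (hn x hxa).symm
    obtain ⟨j, hjn, -⟩ := Nat.find_spec h
    refine ha (mem_of_subset (fun z hz => ?_) (hH j))
    have hz := hj z hz
    simp only [f, dif_pos h] at hz
    split_ifs at hz with h'
    obtain ⟨i', hi', hzi'⟩ := Nat.find_spec h'
    have : Nat.find h' = Nat.find h := by omega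
    rwa [← Encodable.encode_injective (hi'.trans (this.trans hjn.symm))]

/-- A function that is finite-to-one on a positive set is injective on a positive subset. -/
theorem IsWeaklySelective.exists_injOn (hJ : ContainsSingletons J) (hw : IsWeaklySelective J)
    {b : Set E} (hb : b ∉ J) {f : E → ℕ} (hf : ∀ n, (b ∩ f ⁻¹' {n}).Finite) :
    ∃ a ⊆ b, a ∉ J ∧ InjOn f a := by
  obtain ⟨a, hab, ha, hinj | ⟨n, hn⟩⟩ := hw b f hb
  · exact ⟨a, hab, ha, hinj⟩
  · have hsub : a ⊆ b ∩ f ⁻¹' {n} := fun x hx => ⟨hab hx, hn x hx⟩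
    exact absurd (mem_of_subset hsub (finite_mem hJ (hf n))) ha

variable [Encodable E]

/-- The finite set `G` is an initial segment of `x` in the ordering of `E` by codes. -/
def IsInitialSegment (G : Finset E) (x : Set E) : Prop :=
  ↑G ⊆ x ∧ ∀ g ∈ G, ∀ k ∈ x, k ∉ G → Encodable.encode g < Encodable.encode k

/-- Beyond `F`, the elements of `x` avoid the sets `h G` assigned to the initial segments `G` of
`x` that precede them. -/
def IsSparse (h : Finset E → Set E) (F : Finset E) (x : Set E) : Prop :=
  ∀ G, F ⊆ G → IsInitialSegment G x → ∀ k ∈ x, k ∉ G → k ∉ h G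

theorem finite_encode_lt (n : ℕ) : {k : E | Encodable.encode k < n}.Finite :=
  (finite_lt_nat n).preimage Encodable.encode_injective.injOn

open Classical in
theorem IsInitialSegment.exists_insert {G : Finset E} {x : Set E} (hG : IsInitialSegment G x)
    (hx : x.Infinite) : ∃ k ∈ x, k ∉ G ∧ IsInitialSegment (insert k G) x := by
  have hne : (x \ G).Nonempty := (hx.sdiff G.finite_toSet).nonempty
  obtain ⟨k, hk, hmin⟩ : ∃ k ∈ x \ ↑G, ∀ z ∈ x \ ↑G, Encodable.encode k ≤ Encodable.encode z :=
    ⟨Function.argminOn Encodable.encode _ hne, Function.argminOn_mem _ _ hne,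
      fun z hz => Function.argminOn_le _ _ hz⟩
  refine ⟨k, hk.1, hk.2, ?_, ?_⟩
  · intro z hz
    rcases Finset.mem_insert.1 (Finset.mem_coe.1 hz) with rfl | hz
    exacts [hk.1, hG.1 hz]
  · intro g hg z hz hzG
    rw [Finset.mem_insert, not_or] at hzG
    rcases Finset.mem_insert.1 hg with rfl | hg
    · exact lt_of_le_of_ne (hmin z ⟨hz, hzG.2⟩)
        fun h => hzG.1 (Encodable.encode_injective h).symm
    · exact hG.2 g hg z hz hzG.2

/-- The form in which weak selectivity enters the main argument: every positive set contains a
positive set that is sparse for a given assignment of sets of the ideal. -/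
theorem IsWeaklySelective.exists_isSparse (hJ : ContainsSingletons J) (hw : IsWeaklySelective J)
    {h : Finset E → Set E} (hh : ∀ G, h G ∈ J) {b : Set E} (hb : b ∉ J) :
    ∃ x ⊆ b, x ∉ J ∧ IsSparse h ∅ x := by
  classical
  have hb' : b \ h ∅ ∉ J := fun hmem => hb <|
    mem_of_subset (by intro x hx; by_cases hx' : x ∈ h ∅; exacts [Or.inr hx', Or.inl ⟨hx, hx'⟩])
      (union_mem hmem (hh ∅))
  obtain ⟨a, hab, ha, hafin⟩ := hw.exists_finite_inter hh hb'
  -- `M n` bounds all codes in `a ∩ h G`, for every `G` whose codes are below `n`.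
  have hM : ∀ n, ∃ m, n < m ∧ ∀ G : Finset E, (∀ g ∈ G, Encodable.encode g < n) →
      ∀ k ∈ a ∩ h G, Encodable.encode k < m := by
    intro n
    have hfin : (⋃ G ∈ (finite_encode_lt (E := E) n).toFinset.powerset, a ∩ h G).Finite :=
      (Finset.finite_toSet _).biUnion fun G _ => hafin G
    obtain ⟨m, hm⟩ := (hfin.image Encodable.encode).bddAbove
    refine ⟨max m n + 1, by omega, fun G hG k hk => ?_⟩
    have : Encodable.encode k ≤ m := by
      refine hm (mem_image_of_mem _ (mem_iUnion₂.2 ⟨G, ?_, hk⟩))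
      rw [Finset.mem_powerset]
      intro g hg
      simpa using hG g hg
    omega
  choose M hMlt hM using hM
  let m : ℕ → ℕ := fun n => M^[n] 0
  have hmsucc : ∀ n, m (n + 1) = M (m n) := fun n => Function.iterate_succ_apply' M n 0
  have hmono : StrictMono m := strictMono_nat_of_lt_succ fun n => by rw [hmsucc]; exact hMlt _
  have hex : ∀ k : E, ∃ n, Encodable.encode k < m n := fun k =>
    ⟨Encodable.encode k + 1, lt_of_lt_of_le (Nat.lt_succ_self _) (hmono.le_apply)⟩
  -- The codes are cut into the intervals `[m n, m (n + 1))`; `idx k` locates `k` among them.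
  let idx : E → ℕ := fun k => Nat.find (hex k)
  have hidx : ∀ k, Encodable.encode k < m (idx k) := fun k => Nat.find_spec (hex k)
  have hidx' : ∀ k n, n < idx k → m n ≤ Encodable.encode k := fun k n hn =>
    not_lt.1 (Nat.find_min (hex k) hn)
  have hfib : ∀ n, {k | idx k ≤ n}.Finite := fun n =>
    (finite_encode_lt (m n)).subset fun k hk => (hidx k).trans_le (hmono.monotone hk)
  -- Injectivity of both `idx / 2` and `(idx + 1) / 2` leaves no two elements in the same interval
  -- or in adjacent ones.
  obtain ⟨a₁, ha₁a, ha₁, hinj₁⟩ := hw.exists_injOn hJ ha (f := fun k => idx k / 2) fun n =>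
    (hfib (2 * n + 1)).subset fun k hk => by
      have : idx k / 2 = n := hk.2
      simp only [mem_ofPred_eq]; omega
  obtain ⟨a₂, ha₂a, ha₂, hinj₂⟩ := hw.exists_injOn hJ ha₁ (f := fun k => (idx k + 1) / 2) fun n =>
    (hfib (2 * n + 1)).subset fun k hk => by
      have : (idx k + 1) / 2 = n := hk.2
      simp only [mem_ofPred_eq]; omega
  have ha₂a' : a₂ ⊆ a := ha₂a.trans ha₁a
  refine ⟨a₂, fun k hk => (hab (ha₂a' hk)).1, ha₂, ?_⟩
  intro G _ hG k hk hkG hkh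
  rcases G.eq_empty_or_nonempty with rfl | hne
  · exact (hab (ha₂a' hk)).2 hkh
  obtain ⟨g, hg, hgmax⟩ := G.exists_max_image idx hne
  have hlt : Encodable.encode g < Encodable.encode k := hG.2 g hg k hk hkG
  have hgk : g ≠ k := fun hgk => hkG (hgk ▸ hg)
  have hle : idx g ≤ idx k := by
    by_contra hcon
    exact absurd (hidx' g _ (not_le.1 hcon)) (not_le.2 (hlt.trans (hidx k)))
  have h₁ : idx g / 2 ≠ idx k / 2 := fun heq => hgk (hinj₁ (ha₂a (hG.1 hg)) (ha₂a hk) heq)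
  have h₂ : (idx g + 1) / 2 ≠ (idx k + 1) / 2 := fun heq => hgk (hinj₂ (hG.1 hg) hk heq)
  have hgap : idx g + 1 < idx k := by omega
  have hbound := hM (m (idx g)) G
    (fun z hz => (hidx z).trans_le (hmono.monotone (hgmax z hz))) k ⟨ha₂a' hk, hkh⟩
  rw [← hmsucc] at hbound
  exact absurd (hidx' k _ hgap) (not_le.2 hbound)

end Sparse

/-! ### Escaping families -/

section Escape

variable {E : Type*} [Encodable E] {J : Order.Ideal (Set E)} {b : Set E}
  {g : (ℕ → ℕ) → E → Bool}

/-- The subset of `E` with characteristic function `x`. -/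
def trueSet (x : E → Bool) : Set E := {e | x e = true}

/-- The sequence `y` begins with the list `t`. -/
def BeginsWith (t : List ℕ) (y : ℕ → ℕ) : Prop := ∀ i v, t[i]? = some v → y i = v

theorem BeginsWith.append {t : List ℕ} {y : ℕ → ℕ} (h : BeginsWith t y) :
    BeginsWith (t ++ [y t.length]) y := by
  intro i v hv
  rcases lt_trichotomy i t.length with hi | hi | hi
  · rw [List.getElem?_append_left hi] at hv
    exact h i v hv
  · subst hi
    simpa using hv
  · rw [List.getElem?_eq_none (by simp; omega)] at hv
    simp at hv

variable (J b g) in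
/-- A pair of a finite set `F` and a finite list `t` is admissible if, for every assignment `h` of
sets of the ideal, some positive subset `g y` of `b` whose witness `y` begins with `t` has `F` as an
initial segment and is sparse beyond `F`. -/
def IsAdmissible (F : Finset E) (t : List ℕ) : Prop :=
  ∀ h : Finset E → Set E, (∀ G, h G ∈ J) → ∃ y, BeginsWith t y ∧ trueSet (g y) ⊆ b ∧
    IsInitialSegment F (trueSet (g y)) ∧ IsSparse h F (trueSet (g y))

open Classical in
variable (J b g) in
/-- From `F`, by adding elements one at a time, each of them free to range over a positive set, one
can get to a set of at least `t.length` elements that is admissible together with some one-digit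
extension of `t`. -/
inductive CanExtend (t : List ℕ) : Finset E → Prop
  | digit (F : Finset E) (i : ℕ) (hF : t.length ≤ F.card)
      (hadm : IsAdmissible J b g F (t ++ [i])) : CanExtend t F
  | add (F : Finset E) (Y : Set E) (hY : Y ∉ J) (hYb : Y ⊆ b)
      (h : ∀ k ∈ Y, CanExtend t (insert k F)) : CanExtend t F

/-- If `CanExtend t F` failed, a suitable `h` would keep every initial segment `G ⊇ F` of an
`h`-sparse set from satisfying `CanExtend t G`. But the witness of such a set has a next digit `i`,
and an initial segment with at least `i` elements would be admissible for `t ++ [i]`. -/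
theorem IsAdmissible.canExtend (hJ : ContainsSingletons J) (hg : ∀ y, trueSet (g y) ∉ J)
    {F : Finset E} {t : List ℕ} (hadm : IsAdmissible J b g F t) : CanExtend J b g t F := by
  classical
  by_contra hF
  let B : Finset E → Set E := fun G =>
    if CanExtend J b g t G then ∅ else {k | k ∈ b ∧ CanExtend J b g t (insert k G)}
  have hB : ∀ G, B G ∈ J := by
    intro G
    by_cases hG : CanExtend J b g t G
    · simpa only [B, if_pos hG] using empty_mem_set
    · simp only [B, if_neg hG]
      by_contra hmem
      exact hG (CanExtend.add G _ hmem (fun k hk => hk.1) fun k hk => hk.2)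
  have hH : ∀ (G : Finset E) (i : ℕ), ∃ h : Finset E → Set E, (∀ G', h G' ∈ J) ∧
      (¬ CanExtend J b g t G → t.length ≤ G.card → ∀ y, BeginsWith (t ++ [i]) y →
        trueSet (g y) ⊆ b → IsInitialSegment G (trueSet (g y)) →
          ¬ IsSparse h G (trueSet (g y))) := by
    intro G i
    by_cases hG : ¬ CanExtend J b g t G ∧ t.length ≤ G.card
    · have : ¬ IsAdmissible J b g G (t ++ [i]) := fun h => hG.1 (CanExtend.digit G i hG.2 h)
      simp only [IsAdmissible, not_forall] at this
      obtain ⟨h, hh, hno⟩ := this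
      exact ⟨h, hh, fun _ _ y h₁ h₂ h₃ h₄ => hno ⟨y, h₁, h₂, h₃, h₄⟩⟩
    · exact ⟨fun _ => ∅, fun _ => empty_mem_set, fun h₁ h₂ => absurd ⟨h₁, h₂⟩ hG⟩
  choose H hHJ hH using hH
  let h : Finset E → Set E := fun G => ⋃ G' ∈ G.powerset,
    (B G' ∪ ⋃ i ∈ Finset.range (G.card + 1), H G' i G)
  have hh : ∀ G, h G ∈ J := fun G => biUnion_finset_mem _ fun G' _ =>
    union_mem (hB G') (biUnion_finset_mem _ fun i _ => hHJ G' i G)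
  obtain ⟨y, hty, hyb, hinit, hsparse⟩ := hadm h hh
  have hinf : (trueSet (g y)).Infinite := infinite_of_notMem hJ (hg y)
  have hseg : ∀ n : ℕ, ∃ G, F ⊆ G ∧ IsInitialSegment G (trueSet (g y)) ∧
      ¬ CanExtend J b g t G ∧ n ≤ G.card := by
    intro n
    induction n with
    | zero => exact ⟨F, Finset.Subset.refl F, hinit, hF, Nat.zero_le _⟩
    | succ n ih =>
      obtain ⟨G, hFG, hG, hno, hn⟩ := ih
      obtain ⟨k, hk, hkG, hins⟩ := hG.exists_insert hinf
      refine ⟨insert k G, hFG.trans (Finset.subset_insert k G), hins, fun hk' => ?_, ?_⟩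
      · refine hsparse G hFG hG k hk hkG (mem_iUnion₂.2 ⟨G, Finset.mem_powerset_self G, Or.inl ?_⟩)
        simp only [B, if_neg hno]
        exact ⟨hyb hk, hk'⟩
      · rw [Finset.card_insert_of_notMem hkG]; omega
  obtain ⟨G, hFG, hG, hno, hn⟩ := hseg (max t.length (y t.length))
  refine hH G (y t.length) hno ((le_max_left _ _).trans hn) y hty.append hyb hG ?_
  intro G' hGG' hG' k hk hkG' hkh
  refine hsparse G' (hFG.trans hGG') hG' k hk hkG' (mem_iUnion₂.2
    ⟨G, Finset.mem_powerset.2 hGG', Or.inr (mem_iUnion₂.2 ⟨y t.length, ?_, hkh⟩)⟩)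
  have : G.card ≤ G'.card := Finset.card_le_card hGG'
  rw [Finset.mem_range]
  have := (le_max_right _ _).trans hn
  omega

open Classical in
/-- The positive sets over which the added elements range, along a derivation of `CanExtend t F`,
are countably many; a set that meets all of them contains an admissible extension. -/
theorem CanExtend.exists_countable {t : List ℕ} {F : Finset E} (h : CanExtend J b g t F) :
    ∃ 𝒴 : Set (Set E), 𝒴.Countable ∧ (∀ Y ∈ 𝒴, Y ⊆ b ∧ Y ∉ J) ∧
      ∀ a : Set E, (∀ Y ∈ 𝒴, (Y ∩ a).Nonempty) → ↑F ⊆ a →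
        ∃ F' : Finset E, ↑F' ⊆ a ∧ t.length ≤ F'.card ∧
          ∃ i, IsAdmissible J b g F' (t ++ [i]) := by
  induction h with
  | digit F i hF hadm =>
    exact ⟨∅, countable_empty, fun Y hY => hY.elim, fun a _ ha => ⟨F, ha, hF, i, hadm⟩⟩
  | add F Y hY hYb _ ih =>
    choose! 𝒴 hc hpos hext using ih
    refine ⟨insert Y (⋃ k ∈ Y, 𝒴 k), (Y.to_countable.biUnion hc).insert Y, ?_, ?_⟩
    · rintro Z (rfl | hZ)
      · exact ⟨hYb, hY⟩
      · obtain ⟨k, hk, hZk⟩ := mem_iUnion₂.1 hZ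
        exact hpos k hk Z hZk
    · intro a ha hFa
      obtain ⟨k, hkY, hka⟩ := ha Y (mem_insert _ _)
      refine hext k hkY a (fun Z hZ => ha Z (Or.inr (mem_iUnion₂.2 ⟨k, hkY, hZ⟩))) ?_
      intro z hz
      rcases Finset.mem_insert.1 (Finset.mem_coe.1 hz) with rfl | hz
      exacts [hka, hFa hz]

/-- A positive set has countably many positive subsets such that no set of the ideal meets all of
them. -/
theorem IsWeaklySelective.exists_escaping (hJ : ContainsSingletons J) (hco : IsCoanalytic J)
    (hw : IsWeaklySelective J) (hb : b ∉ J) :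
    ∃ 𝒴 : Set (Set E), 𝒴.Countable ∧ (∀ Y ∈ 𝒴, Y ⊆ b ∧ Y ∉ J) ∧
      ∀ a ∈ J, ∃ Y ∈ 𝒴, Disjoint Y a := by
  classical
  have hchar : ∀ s : Set E, trueSet (fun e => decide (e ∈ s)) = s := fun s => by
    ext e; simp [trueSet]
  rw [IsCoanalytic, MeasureTheory.AnalyticSet] at hco
  rcases hco with hemp | ⟨g, hgc, hgr⟩
  · have : (fun e => decide (e ∈ b)) ∈ ({x : E → Bool | {e : E | x e = true} ∈ J}ᶜ) :=
      fun h => hb (by simpa using h)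
    rw [hemp] at this
    exact this.elim
  have hg : ∀ y, trueSet (g y) ∉ J := fun y => by
    have : g y ∈ range g := mem_range_self y
    rw [hgr] at this
    exact this
  have hgs : ∀ s : Set E, s ∉ J → ∃ y, trueSet (g y) = s := by
    intro s hs
    have : (fun e => decide (e ∈ s)) ∈ range g := by
      rw [hgr]
      intro h
      exact hs (by simpa using h)
    obtain ⟨y, hy⟩ := this
    exact ⟨y, by rw [hy, hchar]⟩
  have h₀ : IsAdmissible J b g ∅ [] := by
    intro h hh
    obtain ⟨x, hxb, hx, hsp⟩ := hw.exists_isSparse hJ hh hb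
    obtain ⟨y, rfl⟩ := hgs x hx
    exact ⟨y, fun i v hv => by simp at hv, hxb, ⟨by simp, by simp⟩, hsp⟩
  have hfam : ∀ p : Finset E × List ℕ, ∃ 𝒴 : Set (Set E), 𝒴.Countable ∧
      (∀ Y ∈ 𝒴, Y ⊆ b ∧ Y ∉ J) ∧ (IsAdmissible J b g p.1 p.2 →
        ∀ a : Set E, (∀ Y ∈ 𝒴, (Y ∩ a).Nonempty) → ↑p.1 ⊆ a →
          ∃ F' : Finset E, ↑F' ⊆ a ∧ p.2.length ≤ F'.card ∧
            ∃ i, IsAdmissible J b g F' (p.2 ++ [i])) := by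
    intro p
    by_cases hp : IsAdmissible J b g p.1 p.2
    · obtain ⟨𝒴, h₁, h₂, h₃⟩ := (hp.canExtend hJ hg).exists_countable
      exact ⟨𝒴, h₁, h₂, fun _ => h₃⟩
    · exact ⟨∅, countable_empty, fun Y hY => hY.elim, fun h => absurd h hp⟩
  choose 𝒴 hc hpos hext using hfam
  refine ⟨⋃ p, 𝒴 p, countable_iUnion hc, fun Y hY => ?_, ?_⟩
  · obtain ⟨p, hp⟩ := mem_iUnion.1 hY
    exact hpos p Y hp
  by_contra hcon
  push Not at hcon
  obtain ⟨a, ha, hmeet⟩ := hcon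
  have hmeet' : ∀ p, ∀ Y ∈ 𝒴 p, (Y ∩ a).Nonempty := fun p Y hY =>
    not_disjoint_iff_nonempty_inter.1 (hmeet Y (mem_iUnion.2 ⟨p, hY⟩))
  -- Otherwise admissible pairs inside some `a ∈ J` grow to the witness of a positive subset of `a`.
  have hstep : ∀ p : {p : Finset E × List ℕ // IsAdmissible J b g p.1 p.2 ∧ ↑p.1 ⊆ a},
      ∃ q : {p : Finset E × List ℕ // IsAdmissible J b g p.1 p.2 ∧ ↑p.1 ⊆ a},
        p.1.2.length ≤ q.1.1.card ∧ ∃ i, q.1.2 = p.1.2 ++ [i] := by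
    rintro ⟨p, hp, hpa⟩
    obtain ⟨F', hF'a, hcard, i, hi⟩ := hext p hp a (hmeet' p) hpa
    exact ⟨⟨(F', p.2 ++ [i]), hi, hF'a⟩, hcard, i, rfl⟩
  choose next hcard digit hdigit using hstep
  let s : ℕ → {p : Finset E × List ℕ // IsAdmissible J b g p.1 p.2 ∧ ↑p.1 ⊆ a} := fun n =>
    next^[n] ⟨(∅, []), h₀, by simp⟩
  have hs : ∀ n, s (n + 1) = next (s n) := fun n => Function.iterate_succ_apply' next n _
  have hlen : ∀ n, (s n).1.2.length = n := by
    intro n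
    induction n with
    | zero => rfl
    | succ n ih => rw [hs, hdigit, List.length_append, ih]; rfl
  let y : ℕ → ℕ := fun n => digit (s n)
  have hy : ∀ n i, i < n → (s n).1.2[i]? = some (y i) := by
    intro n
    induction n with
    | zero => intro i hi; omega
    | succ n ih =>
      intro i hi
      rw [hs, hdigit]
      rcases Nat.lt_succ_iff_lt_or_eq.1 hi with hi | rfl
      · rw [List.getElem?_append_left (by rw [hlen]; exact hi)]
        exact ih i hi
      · rw [List.getElem?_append_right (by rw [hlen]), hlen]
        simp [y]
  have hz : ∀ n, ∃ z, BeginsWith (s n).1.2 z ∧ IsInitialSegment (s n).1.1 (trueSet (g z)) := by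
    intro n
    obtain ⟨z, h₁, -, h₂, -⟩ := (s n).2.1 (fun _ => ∅) fun _ => empty_mem_set
    exact ⟨z, h₁, h₂⟩
  choose z hzs hzi using hz
  have hlim : Tendsto z atTop (𝓝 y) := by
    rw [tendsto_pi_nhds]
    intro i
    refine tendsto_const_nhds.congr' ?_
    filter_upwards [eventually_gt_atTop i] with n hn
    exact (hzs n i _ (hy n i hn)).symm
  refine hg y (mem_of_subset (fun k hk => ?_) ha)
  by_contra hka
  have hopen : IsOpen {w : ℕ → ℕ | g w k = true} :=
    (isOpen_discrete {true}).preimage ((continuous_apply k).comp hgc)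
  obtain ⟨n, hn, hnk⟩ := ((hlim.eventually (hopen.mem_nhds hk)).and
    (eventually_gt_atTop (Encodable.encode k + 1))).exists
  obtain ⟨n, rfl⟩ : ∃ n', n = n' + 1 := ⟨n - 1, by omega⟩
  -- All elements of the `n`-th finite set precede `k`, so that it has at most `encode k` elements.
  have hle : (s (n + 1)).1.1.card ≤ (Finset.range (Encodable.encode k)).card := by
    refine Finset.card_le_card_of_injOn Encodable.encode (fun x hx => ?_)
      Encodable.encode_injective.injOn
    rw [Finset.mem_coe, Finset.mem_range]
    exact (hzi (n + 1)).2 x hx k hn fun hk' => hka ((s (n + 1)).2.2 hk')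
  have hge : n ≤ (s (n + 1)).1.1.card := by
    have := hcard (s n)
    rwa [hlen, ← hs] at this
  rw [Finset.card_range] at hle
  omega

/-- A positive set has countably many positive subsets, two of them disjoint, such that no set of
the ideal meets all of them. -/
theorem IsWeaklySelective.exists_escaping_seq (hJ : ContainsSingletons J) (hco : IsCoanalytic J)
    (hw : IsWeaklySelective J) (hb : b ∉ J) :
    ∃ Y : ℕ → Set E, (∀ n, Y n ⊆ b ∧ Y n ∉ J) ∧ (∀ a ∈ J, ∃ n, Disjoint (Y n) a) ∧
      ∃ m n, Disjoint (Y m) (Y n) := by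
  obtain ⟨𝒴, hc, hpos, hesc⟩ := hw.exists_escaping hJ hco hb
  obtain ⟨c, hcb, hc₁, hc₂⟩ : ∃ c ⊆ b, c ∉ J ∧ b \ c ∉ J := by
    -- Otherwise `𝒴` would be a base of a nonprincipal ultrafilter; but some set splits all of its
    -- members.
    by_contra hcon
    push Not at hcon
    have : Countable 𝒴 := hc.to_subtype
    obtain ⟨v, hv, hvmem⟩ := exists_injective_choice (ι := 𝒴 × Bool) (S := fun p => (p.1 : Set E))
      fun p => infinite_of_notMem hJ (hpos p.1 p.1.2).2
    let c : Set E := range fun Z : 𝒴 => v (Z, true)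
    have hcb : c ⊆ b := by
      rintro _ ⟨Z, rfl⟩
      exact (hpos Z Z.2).1 (hvmem (Z, true))
    by_cases hcJ : c ∈ J
    · obtain ⟨Z, hZ, hdis⟩ := hesc c hcJ
      exact disjoint_left.1 hdis (hvmem (⟨Z, hZ⟩, true)) ⟨⟨Z, hZ⟩, rfl⟩
    · obtain ⟨Z, hZ, hdis⟩ := hesc _ (hcon c hcb hcJ)
      have hmem : v (⟨Z, hZ⟩, false) ∈ Z := hvmem (⟨Z, hZ⟩, false)
      refine disjoint_left.1 hdis hmem ⟨(hpos Z hZ).1 hmem, ?_⟩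
      rintro ⟨W, hW⟩
      simpa using hv hW
  obtain ⟨Y, hY⟩ := ((hc.insert (b \ c)).insert c).exists_eq_range ⟨c, mem_insert _ _⟩
  have hYmem : ∀ n, Y n ∈ insert c (insert (b \ c) 𝒴) := fun n => hY ▸ mem_range_self n
  have hYex : ∀ Z ∈ insert c (insert (b \ c) 𝒴), ∃ n, Y n = Z := fun Z hZ => by rwa [hY] at hZ
  refine ⟨Y, fun n => ?_, fun a ha => ?_, ?_⟩
  · rcases hYmem n with h | h | h
    · rw [h]; exact ⟨hcb, hc₁⟩
    · rw [h]; exact ⟨sdiff_subset, hc₂⟩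
    · exact hpos _ h
  · obtain ⟨Z, hZ, hdis⟩ := hesc a ha
    obtain ⟨n, rfl⟩ := hYex Z (by simp [hZ])
    exact ⟨n, hdis⟩
  · obtain ⟨m, hm⟩ := hYex c (by simp)
    obtain ⟨n, hn⟩ := hYex (b \ c) (by simp)
    exact ⟨m, n, by rw [hm, hn]; exact disjoint_sdiff_right⟩

end Escape

/-! ### Construction of a representation -/

section Representation

variable {E : Type*} {Z : Type} [TopologicalSpace Z]

/-- The ideal of the subsets of `E` whose image under `e` has its closure in the `σ`-ideal `I`. -/
def closureIdeal (e : E → Z) (I : Set (Set Z)) (hI : IsSigmaIdeal I) : Order.Ideal (Set E) where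
  carrier := {a | closure (e '' a) ∈ I}
  lower' _ _ hab ha := hI.mem_of_subset _ _ (closure_mono (image_mono hab)) ha
  nonempty' := ⟨∅, by simpa using hI.empty_mem⟩
  directed' a ha c hc := by
    refine ⟨a ∪ c, ?_, subset_union_left, subset_union_right⟩
    refine hI.mem_of_subset _ (⋃ n : ℕ, if n = 0 then closure (e '' a) else closure (e '' c)) ?_
      (hI.iUnion_mem _ fun n => ?_)
    · rw [image_union, closure_union]
      rintro x (hx | hx)
      · exact mem_iUnion.2 ⟨0, by simpa using hx⟩
      · exact mem_iUnion.2 ⟨1, by simpa using hx⟩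
    · split_ifs
      exacts [ha, hc]

theorem mem_closureIdeal {e : E → Z} {I : Set (Set Z)} {hI : IsSigmaIdeal I} {a : Set E} :
    a ∈ closureIdeal e I hI ↔ closure (e '' a) ∈ I := Iff.rfl

theorem hasTopologicalRepresentation_closureIdeal [Countable E] [SecondCountableTopology Z]
    [TopologicalSpace.MetrizableSpace Z] {e : E → Z} (he : Function.Injective e)
    {I : Set (Set Z)} (hI : IsSigmaIdeal I) :
    HasTopologicalRepresentation (closureIdeal e I hI) := by
  -- The space is the closure of the range of `e`, in which that range is dense.
  let X : Set Z := closure (range e)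
  let e' : E → X := fun x => ⟨e x, subset_closure (mem_range_self x)⟩
  have he' : Function.Injective e' := fun x y h => he (congrArg Subtype.val h)
  refine ⟨X, inferInstance, inferInstance, inferInstance, {S | (Subtype.val '' S : Set Z) ∈ I},
    range e', Equiv.ofInjective e' he', ⟨?_, ?_, ?_, ?_⟩, countable_range e', ?_, ?_⟩
  · simpa using hI.empty_mem
  · exact fun s t hst ht => hI.mem_of_subset _ _ (image_mono hst) ht
  · intro s hs
    rw [mem_ofPred_eq, image_iUnion]
    exact hI.iUnion_mem _ hs
  · intro x
    rw [mem_ofPred_eq, image_singleton]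
    exact hI.singleton_mem _
  · intro x
    rw [closure_subtype, ← range_comp]
    exact x.2
  · intro a
    have hcl : IsClosedEmbedding (Subtype.val : X → Z) :=
      isClosed_closure.isClosedEmbedding_subtypeVal
    rw [mem_closureIdeal, closureFamily, mem_ofPred_eq, mem_ofPred_eq, ← hcl.closure_image_eq,
      image_image, image_image]
    rfl

/-- The `σ`-ideal generated by the points and the closures of the images of the sets of `J`. -/
def generatedSigmaIdeal (e : E → Z) (J : Order.Ideal (Set E)) : Set (Set Z) :=
  {S | ∃ (a : ℕ → Set E) (p : ℕ → Z), (∀ n, a n ∈ J) ∧ S ⊆ ⋃ n, (closure (e '' a n) ∪ {p n})}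

theorem isSigmaIdeal_generatedSigmaIdeal [Nonempty Z] (e : E → Z) (J : Order.Ideal (Set E)) :
    IsSigmaIdeal (generatedSigmaIdeal e J) where
  empty_mem := ⟨fun _ => ∅, fun _ => Classical.arbitrary Z, fun _ => empty_mem_set, empty_subset _⟩
  mem_of_subset := fun _ _ hst ⟨a, p, ha, ht⟩ => ⟨a, p, ha, hst.trans ht⟩
  iUnion_mem := by
    intro s hs
    choose a p ha hp using hs
    refine ⟨fun n => a n.unpair.1 n.unpair.2, fun n => p n.unpair.1 n.unpair.2,
      fun n => ha _ _, iUnion_subset fun m x hx => ?_⟩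
    obtain ⟨n, hn⟩ := mem_iUnion.1 (hp m hx)
    exact mem_iUnion.2 ⟨Nat.pair m n, by simpa using hn⟩
  singleton_mem := fun x => ⟨fun _ => ∅, fun _ => x, fun _ => empty_mem_set, fun _ hy =>
    mem_iUnion.2 ⟨0, Or.inr hy⟩⟩

/-- A positive set is left out by an ideal that has a topological representation and includes the
given one. -/
theorem IsWeaklySelective.exists_representation [Countable E] {J : Order.Ideal (Set E)}
    (hJ : ContainsSingletons J) (hco : IsCoanalytic J) (hw : IsWeaklySelective J) {b : Set E}
    (hb : b ∉ J) :
    ∃ K : Order.Ideal (Set E), HasTopologicalRepresentation K ∧ J ≤ K ∧ b ∉ K := by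
  classical
  obtain ⟨enc⟩ := nonempty_encodable E
  choose! Y hYpos hYesc hYdis using fun (c : Set E) (hc : c ∉ J) =>
    hw.exists_escaping_seq hJ hco hc
  -- The family `X` contains `b` and is closed under passing from a set `c` to the sets `Y c n`.
  let X : List ℕ → Set E := fun l => l.foldr (fun n c => Y c n) b
  have hXpos : ∀ l, X l ∉ J := by
    intro l
    induction l with
    | nil => exact hb
    | cons n l ih => exact (hYpos _ ih n).2
  let e : E → (List ℕ ⊕ ℕ → Bool) := fun k =>
    Sum.elim (fun l : List ℕ => decide (k ∈ X l)) (fun n : ℕ => decide (Encodable.encode k = n))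
  have he : Function.Injective e := by
    intro k k' h
    have := congrFun h (Sum.inr (Encodable.encode k'))
    simpa [e] using this
  -- The sets `X l` are traces of clopen sets, so that disjointness passes to closures.
  have htrue : ∀ l, ∀ z ∈ closure (e '' X l), z (Sum.inl l) = true := by
    intro l
    have hcl : IsClosed {z : List ℕ ⊕ ℕ → Bool | z (Sum.inl l) = true} :=
      isClosed_eq (continuous_apply _) continuous_const
    refine closure_minimal ?_ hcl
    rintro _ ⟨k, hk, rfl⟩
    exact decide_eq_true hk
  have hdisj : ∀ l a, Disjoint (X l) a → ∀ z ∈ closure (e '' X l), z ∉ closure (e '' a) := by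
    intro l a hla z hz hza
    have hfalse : ∀ z ∈ closure (e '' a), z (Sum.inl l) = false := by
      have hcl : IsClosed {z : List ℕ ⊕ ℕ → Bool | z (Sum.inl l) = false} :=
        isClosed_eq (continuous_apply _) continuous_const
      refine closure_minimal ?_ hcl
      rintro _ ⟨k, hk, rfl⟩
      exact decide_eq_false (disjoint_right.1 hla hk)
    simpa [htrue l z hz] using hfalse z hza
  refine ⟨closureIdeal e _ (isSigmaIdeal_generatedSigmaIdeal e J),
    hasTopologicalRepresentation_closureIdeal he _, fun a ha => ?_, ?_⟩
  · exact ⟨fun _ => a, fun _ => fun _ => true, fun _ => ha, fun z hz =>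
      mem_iUnion.2 ⟨0, Or.inl hz⟩⟩
  rintro ⟨a, p, ha, hcov⟩
  have hstep : ∀ n l, ∃ l', X l' ⊆ X l ∧
      ∀ z ∈ closure (e '' X l'), z ∉ closure (e '' a n) ∪ {p n} := by
    intro n l
    obtain ⟨i, hi⟩ := hYesc _ (hXpos l) _ (ha n)
    obtain ⟨j, j', hjj'⟩ := hYdis _ (hXpos (i :: l))
    have hsub : ∀ j, X (j :: i :: l) ⊆ X (i :: l) := fun j => (hYpos _ (hXpos (i :: l)) j).1
    -- The point `p n` lies in the closure of at most one of two disjoint sets of the family.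
    obtain ⟨j, hj⟩ : ∃ j, p n ∉ closure (e '' X (j :: i :: l)) := by
      by_cases hp : p n ∈ closure (e '' X (j :: i :: l))
      · exact ⟨j', hdisj (j :: i :: l) _ hjj' _ hp⟩
      · exact ⟨j, hp⟩
    refine ⟨j :: i :: l, (hsub j).trans (hYpos _ (hXpos l) i).1, ?_⟩
    rintro z hz (hza | rfl)
    · exact hdisj (i :: l) (a n) hi z (closure_mono (image_mono (hsub j)) hz) hza
    · exact hj hz
  choose next hnext havoid using hstep
  let s : ℕ → List ℕ := fun n => Nat.rec [] next n
  obtain ⟨z, hz⟩ := IsCompact.nonempty_iInter_of_sequence_nonempty_isCompact_isClosed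
    (fun n => closure (e '' X (s n))) (fun n => closure_mono (image_mono (hnext n (s n))))
    (fun n => ((infinite_of_notMem hJ (hXpos (s n))).nonempty.image e).closure)
    isClosed_closure.isCompact (fun n => isClosed_closure)
  rw [mem_iInter] at hz
  obtain ⟨n, hn⟩ := mem_iUnion.1 (hcov (hz 0))
  exact havoid n (s n) z (hz (n + 1)) hn

end Representation

theorem theorem1p5 {E : Type*} [Countable E] (J : Order.Ideal (Set E))
    (hJ : ContainsSingletons J) (hco : IsCoanalytic J) :
    IsWeaklySelective J ↔
      ∃ F : Set (Order.Ideal (Set E)),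
        (∀ K ∈ F, HasTopologicalRepresentation K) ∧
          (J : Set (Set E)) = ⋂ K ∈ F, (K : Set (Set E)) := by
  constructor
  · intro hw
    refine ⟨{K | HasTopologicalRepresentation K ∧ J ≤ K}, fun K hK => hK.1, ?_⟩
    ext b
    simp only [mem_iInter, SetLike.mem_coe]
    refine ⟨fun hb K hK => hK.2 hb, fun h => ?_⟩
    by_contra hb
    obtain ⟨K, hK, hJK, hbK⟩ := hw.exists_representation hJ hco hb
    exact hbK (h K ⟨hK, hJK⟩)
  · rintro ⟨F, hF, hJF⟩ b f hb
    have hmem : ∀ a : Set E, a ∈ J ↔ ∀ K ∈ F, a ∈ K := fun a => by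
      rw [← SetLike.mem_coe, hJF]
      simp
    obtain ⟨K, hK, hbK⟩ : ∃ K ∈ F, b ∉ K := by
      by_contra hcon
      push Not at hcon
      exact hb ((hmem b).2 hcon)
    obtain ⟨a, hab, ha, h⟩ := (hF K hK).isWeaklySelective b f hbK
    exact ⟨a, hab, fun haJ => ha ((hmem a).1 haJ K hK), h⟩
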